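/- Let $A=(a_{i,j})$ be a real $n\times n$ nonsingular M-matrix, i.e. $a_{i,j}\le 0$ for all $i\ne j$, $A$ is invertible, and all entries of $A^{-1}$ are nonnegative. Let $D=\mathrm{diag}(a_{1,1},\dots,a_{n,n})$ and write $A=D-B$, so that $B=(b_{i,j})$ has nonnegative entries and zero diagonal. Let $S(B)$ be the matrix with entries $(b_{i,j}b_{j,i})^{1/2}$, and set $A_{sym}=D-S(B)$, $\overline A=D^{-1}A$ and $\overline A_{sym}=D^{-1}A_{sym}$. Let $|\cdot|$ denote the determinant. Let $\alpha>0$. A random vector $X=(X_1,\dots,X_n)$ with values in $\mathbb R^n$ is called an $\alpha$-permanental vector with kernel $R$, where $R$ is a real $n\times n$ matrix, if for all $s_1,\dots,s_n\ge 0$ $$E\Big(e^{-\sum_{i=1}^n s_iX_i}\Big)=\frac{1}{|I+R\,\mathrm{diag}(s_1,\dots,s_n)|^{\alpha}}<\infty .$$ Theorem. Let $X$ and $\widetilde X$ be $\alpha$-permanental vectors with kernels $A^{-1}$ and $A_{sym}^{-1}$, respectively (not necessarily defined on the same probability space). Then for every Borel measurable function $f:\mathbb R^n\to[0,\infty]$,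 $$E\big(f(X)\big)\ \ge\ \frac{|\overline A|^{\alpha}}{|\overline A_{sym}|^{\alpha}}\,E\big(f(\widetilde X)\big),$$ where both expectations are understood as elements of $[0,\infty]$. -/

import Mathlib

open MeasureTheory
open scoped ENNReal

/-- A real square matrix is a nonsingular M-matrix if its off-diagonal entries are nonpositive,
it is invertible, and all entries of its inverse are nonnegative. -/
structure IsNonsingularMMatrix {n : ℕ} (A : Matrix (Fin n) (Fin n) ℝ) : Prop where
  offDiag_nonpos : ∀ i j, i ≠ j → A i j ≤ 0
  isUnit_det : IsUnit A.det
  inv_nonneg : ∀ i j, 0 ≤ A⁻¹ i j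

/-- The diagonal part `D` of `A`. -/
def diagPart {n : ℕ} (A : Matrix (Fin n) (Fin n) ℝ) : Matrix (Fin n) (Fin n) ℝ :=
  Matrix.diagonal A.diag

/-- The matrix `B` in the decomposition `A = D - B`. -/
def offDiagPart {n : ℕ} (A : Matrix (Fin n) (Fin n) ℝ) : Matrix (Fin n) (Fin n) ℝ :=
  diagPart A - A

/-- For a matrix `C` with nonnegative entries, `S(C)` has entries `(c i j * c j i) ^ (1/2)`. -/
noncomputable def geomSymm {n : ℕ} (C : Matrix (Fin n) (Fin n) ℝ) :
    Matrix (Fin n) (Fin n) ℝ :=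
  Matrix.of fun i j => Real.sqrt (C i j * C j i)

/-- `A_sym = D - S(B)`, where `A = D - B`. -/
noncomputable def symMatrix {n : ℕ} (A : Matrix (Fin n) (Fin n) ℝ) :
    Matrix (Fin n) (Fin n) ℝ :=
  diagPart A - geomSymm (offDiagPart A)

/-- The normalization `D⁻¹ A` of `A` by its diagonal part `D`. -/
noncomputable def barMatrix {n : ℕ} (A : Matrix (Fin n) (Fin n) ℝ) :
    Matrix (Fin n) (Fin n) ℝ :=
  (diagPart A)⁻¹ * A

/-- `X` is an `α`-permanental random vector with kernel `R` under `P`: it is an `ℝⁿ`-valued random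
vector whose Laplace transform is finite and equal to `|I + R S| ^ (-α)` for all diagonal matrices
`S` with nonnegative entries `s 1, …, s n`. -/
structure IsPermanental {Ω : Type*} [MeasurableSpace Ω] (P : Measure Ω) {n : ℕ} (α : ℝ)
    (R : Matrix (Fin n) (Fin n) ℝ) (X : Ω → Fin n → ℝ) : Prop where
  aemeasurable : AEMeasurable X P
  integrable : ∀ s : Fin n → ℝ, (∀ i, 0 ≤ s i) →
    Integrable (fun ω => Real.exp (-∑ i, s i * X ω i)) P
  laplace : ∀ s : Fin n → ℝ, (∀ i, 0 ≤ s i) →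
    ∫ ω, Real.exp (-∑ i, s i * X ω i) ∂P = 1 / (1 + R * Matrix.diagonal s).det ^ α

/-!
Write `A = D - B` and `Q = (D + S)⁻¹ B`, where `S = diag s`. Then `det (A + S)` is the product of
`det (D + S)` and `det (1 - Q)`, so that the Laplace transform of `X` is
`|Ā| ^ α * (∏ dᵢ / (dᵢ + sᵢ)) ^ α * exp (α * ∑ tr (Q ^ k) / k)`.
The series in the exponent is a power series, with nonnegative coefficients, in the variables
`tᵢ = dᵢ / (dᵢ + sᵢ)`, and a monomial `t ^ m` is the Laplace transform of a product of gamma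
distributions with shapes `mᵢ` and rates `dᵢ`. Hence the exponent is the Laplace transform of a
measure (`logDetMeasure`), its exponential that of a convolution exponential, and, by uniqueness of
Laplace transforms, the law of `X` is `|Ā| ^ α` times the measure `permanentalMeasure α d B`
(`IsPermanental.map_eq`). The same holds for `X'` with `S(B)` in place of `B`.

It remains to see that `permanentalMeasure` does not increase when `B` is replaced by `S(B)`. All
operations in its construction are monotone in the coefficients of the polynomials `tr (Q ^ k)`.
Such a coefficient is a sum over closed paths of products of entries of `B`; the weight of a path
under `S(B)` is the geometric mean of the weights of the path and of its reversal under `B`, and so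
is at most their arithmetic mean, while reversal permutes the closed paths with given numbers of
visits (`coeff_trace_pathMatrix_geomSymm_pow_le`). To avoid an enumeration of paths the inequality
is proved for all entries of the powers, by induction with the Cauchy-Schwarz inequality.

The expansion of `log det (1 - Q)` rests on the convergence of the Neumann series of `Q`. For `B`
it follows from the nonnegativity of `A⁻¹`, and for `S(B)` from the inequality between the path
sums; in particular this shows that `A_sym` is invertible.
-/

open Filter Topology
open scoped NNReal BoundedContinuousFunction

/-! ### The Neumann series of a nonnegative matrix and the logarithm of the determinant -/

namespace Matrix

variable {n : ℕ}

theorem pow_apply_le_pow_apply {P Q : Matrix (Fin n) (Fin n) ℝ} (hP : ∀ i j, 0 ≤ P i j)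
    (hPQ : ∀ i j, P i j ≤ Q i j) (k : ℕ) (i j : Fin n) : (P ^ k) i j ≤ (Q ^ k) i j := by
  induction k generalizing i j with
  | zero => simp
  | succ k ih =>
    rw [pow_succ, pow_succ, mul_apply, mul_apply]
    exact Finset.sum_le_sum fun l _ => mul_le_mul (ih i l) (hPQ l j) (hP l j)
      ((pow_apply_nonneg hP k i l).trans (ih i l))

/-- The Neumann series of a nonnegative matrix `Q` converges when `1 - Q` has a nonnegative inverse
`N`: its partial sums are `N - Q ^ K * N ≤ N`. -/
theorem summable_pow_apply_of_one_sub_mul_eq_one {Q N : Matrix (Fin n) (Fin n) ℝ}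
    (hQ : ∀ i j, 0 ≤ Q i j) (hN : ∀ i j, 0 ≤ N i j) (h : (1 - Q) * N = 1) (i j : Fin n) :
    Summable fun k => (Q ^ k) i j := by
  refine summable_of_sum_range_le (c := N i j) (fun k => pow_apply_nonneg hQ k i j) fun K => ?_
  have h1 : ∑ k ∈ Finset.range K, Q ^ k = N - Q ^ K * N := by
    calc ∑ k ∈ Finset.range K, Q ^ k = (∑ k ∈ Finset.range K, Q ^ k) * ((1 - Q) * N) := by
          rw [h, mul_one]
      _ = N - Q ^ K * N := by rw [← mul_assoc, geom_sum_mul_neg, sub_mul, one_mul]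
  have h2 : ∑ k ∈ Finset.range K, (Q ^ k) i j = N i j - (Q ^ K * N) i j := by
    rw [← sub_apply, ← h1, sum_apply]
  have h3 : 0 ≤ (Q ^ K * N) i j := by
    rw [mul_apply]
    exact Finset.sum_nonneg fun l _ => mul_nonneg (pow_apply_nonneg hQ K i l) (hN l j)
  linarith

theorem summable_trace_pow {Q : Matrix (Fin n) (Fin n) ℝ}
    (hs : ∀ i j, Summable fun k => (Q ^ k) i j) : Summable fun k : ℕ => (Q ^ k).trace :=
  summable_sum (f := fun (i : Fin n) (k : ℕ) => (Q ^ k) i i) fun i _ => hs i i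

theorem hasDerivAt_det_one_add_smul (M : Matrix (Fin n) (Fin n) ℝ) :
    HasDerivAt (fun h : ℝ => (1 + h • M).det) M.trace 0 := by
  have h := (det (1 + (Polynomial.X : Polynomial ℝ) • M.map Polynomial.C)).hasDerivAt 0
  rw [derivative_det_one_add_X_smul] at h
  refine h.congr_of_eventuallyEq (Eventually.of_forall fun x => ?_)
  simp only [← Polynomial.coe_evalRingHom, RingHom.map_det]
  congr 1
  ext i j
  rcases eq_or_ne i j with rfl | hij
  · simp [mul_comm x]
  · simp [hij, mul_comm x]

/-- Jacobi's formula along the ray `z ↦ 1 - z • Q`. -/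
theorem hasDerivAt_det_one_sub_smul {Q W : Matrix (Fin n) (Fin n) ℝ} {z : ℝ}
    (hW : (1 - z • Q) * W = 1) :
    HasDerivAt (fun y : ℝ => (1 - y • Q).det) (-((1 - z • Q).det * (W * Q).trace)) z := by
  have h0 := (hasDerivAt_det_one_add_smul (-(W * Q)))
  -- `1 - y • Q = (1 - z • Q) * (1 - (y - z) • (W * Q))`
  have h1 : HasDerivAt (fun y : ℝ => (1 + (y - z) • (-(W * Q))).det) (-(W * Q)).trace z := by
    exact HasDerivAt.comp_sub_const (x := z) (a := z)
      (f := fun h : ℝ => (1 + h • (-(W * Q))).det) (by simpa using h0)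
  have h2 := h1.const_mul (1 - z • Q).det
  rw [trace_neg, mul_neg] at h2
  refine h2.congr_of_eventuallyEq (Eventually.of_forall fun y => ?_)
  simp only
  rw [← det_mul]
  congr 1
  rw [mul_add, mul_one, Matrix.mul_smul, mul_neg, ← mul_assoc, hW, one_mul, sub_smul, smul_neg,
    smul_neg]
  abel

/-- The exponential form of the expansion of `log det (1 - Q)`: by Jacobi's formula the function
`z ↦ det (1 - z • Q) * exp (∑ z ^ k * tr (Q ^ k) / k)` has derivative zero on `[0, 1)`, and it is
continuous on `[0, 1]`. -/
theorem det_one_sub_mul_exp_tsum {Q : Matrix (Fin n) (Fin n) ℝ}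
    (hQ : ∀ i j, 0 ≤ Q i j) (hs : ∀ i j, Summable fun k => (Q ^ k) i j) :
    (1 - Q).det * Real.exp (∑' k : ℕ, (Q ^ (k + 1)).trace / (k + 1)) = 1 := by
  have htr : Summable fun k : ℕ => (Q ^ (k + 1)).trace := by
    exact (summable_nat_add_iff (f := fun k => (Q ^ k).trace) 1).2 (summable_trace_pow hs)
  have htr0 : ∀ k, 0 ≤ (Q ^ k).trace := fun k =>
    Finset.sum_nonneg fun i _ => pow_apply_nonneg hQ k i i
  set g : ℝ → ℝ := fun z => ∑' k : ℕ, z ^ (k + 1) * ((Q ^ (k + 1)).trace / (k + 1)) with hg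
  have hdiv : ∀ k : ℕ, (Q ^ (k + 1)).trace / (k + 1) ≤ (Q ^ (k + 1)).trace := fun k =>
    div_le_self (htr0 _) (by linarith [(Nat.cast_nonneg k : (0 : ℝ) ≤ k)])
  have hdiv0 : ∀ k : ℕ, 0 ≤ (Q ^ (k + 1)).trace / (k + 1) := fun k =>
    div_nonneg (htr0 _) (by positivity)
  have hgc : ContinuousOn g (Set.Icc 0 1) := by
    refine continuousOn_tsum (fun k => by fun_prop) htr fun k z hz => ?_
    rw [norm_mul, norm_pow, Real.norm_eq_abs, Real.norm_eq_abs, abs_of_nonneg hz.1,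
      abs_of_nonneg (hdiv0 k)]
    exact (mul_le_of_le_one_left (hdiv0 k) (pow_le_one₀ hz.1 hz.2)).trans (hdiv k)
  have hgd : ∀ z ∈ Set.Ico (0 : ℝ) 1,
      HasDerivAt g (∑' k : ℕ, z ^ k * (Q ^ (k + 1)).trace) z := by
    intro z hz
    refine hasDerivAt_tsum_of_isPreconnected (t := Set.Ioo (-1) 1) (y₀ := 0)
      (g' := fun k z => z ^ k * (Q ^ (k + 1)).trace) htr isOpen_Ioo
      isPreconnected_Ioo (fun k y _ => ?_) (fun k y hy => ?_) (by simp) ?_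
      ⟨by linarith [hz.1], hz.2⟩
    · have := (hasDerivAt_pow (k + 1) y).mul_const ((Q ^ (k + 1)).trace / (k + 1))
      refine this.congr_deriv ?_
      have : (k : ℝ) + 1 ≠ 0 := by positivity
      push_cast
      field_simp
    · rw [norm_mul, norm_pow, Real.norm_eq_abs, Real.norm_eq_abs, abs_of_nonneg (htr0 _)]
      exact mul_le_of_le_one_left (htr0 _) (pow_le_one₀ (abs_nonneg _)
        (abs_le.2 ⟨hy.1.le, hy.2.le⟩))
    · simp
  -- `W` is the sum of the Neumann series of `z • Q`
  have hW : ∀ z ∈ Set.Ico (0 : ℝ) 1, ∃ W : Matrix (Fin n) (Fin n) ℝ,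
      (1 - z • Q) * W = 1 ∧ (W * Q).trace = ∑' k : ℕ, z ^ k * (Q ^ (k + 1)).trace := by
    intro z hz
    have hs' : Summable fun k => (z • Q) ^ k := by
      refine Pi.summable.2 fun i => Pi.summable.2 fun j => ?_
      refine Summable.of_nonneg_of_le (fun k => ?_) (fun k => ?_) (hs i j)
      · exact pow_apply_nonneg (fun i j => mul_nonneg hz.1 (hQ i j)) k i j
      · rw [smul_pow, smul_apply, smul_eq_mul]
        exact mul_le_of_le_one_left (pow_apply_nonneg hQ k i j) (pow_le_one₀ hz.1 hz.2.le)
    refine ⟨∑' k, (z • Q) ^ k, hs'.one_sub_mul_tsum_pow, ?_⟩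
    rw [← hs'.tsum_mul_right]
    have h1 : HasSum (fun k => (z • Q) ^ k * Q) (∑' k, (z • Q) ^ k * Q) :=
      (hs'.mul_right Q).hasSum
    have h2 := h1.map (traceAddMonoidHom (Fin n) ℝ) (Continuous.matrix_trace continuous_id)
    rw [show (∑' k, (z • Q) ^ k * Q).trace =
      traceAddMonoidHom (Fin n) ℝ (∑' k, (z • Q) ^ k * Q) from rfl, ← h2.tsum_eq]
    refine tsum_congr fun k => ?_
    simp [smul_pow, pow_succ]
  have hF := constant_of_has_deriv_right_zero (a := (0 : ℝ)) (b := 1)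
    (f := fun z : ℝ => (1 - z • Q).det * Real.exp (g z))
    (ContinuousOn.mul (Continuous.continuousOn (Continuous.matrix_det (by fun_prop)))
      (Real.continuous_exp.comp_continuousOn hgc))
    (fun z hz => by
      obtain ⟨W, hW1, hW2⟩ := hW z hz
      have h := (hasDerivAt_det_one_sub_smul hW1).mul (hgd z hz).exp
      rw [hW2] at h
      exact (h.congr_deriv (by ring)).hasDerivWithinAt)
    1 (Set.right_mem_Icc.2 zero_le_one)
  simpa [hg] using hF

theorem det_one_sub_pos {Q : Matrix (Fin n) (Fin n) ℝ}
    (hQ : ∀ i j, 0 ≤ Q i j) (hs : ∀ i j, Summable fun k => (Q ^ k) i j) :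
    0 < (1 - Q).det := by
  have h := det_one_sub_mul_exp_tsum hQ hs
  by_contra! hle
  have := mul_nonpos_of_nonpos_of_nonneg hle
    (Real.exp_pos (∑' k : ℕ, (Q ^ (k + 1)).trace / (k + 1))).le
  linarith

/-- The expansion `-log det (1 - Q) = ∑ tr (Q ^ k) / k`. -/
theorem hasSum_trace_pow_div {Q : Matrix (Fin n) (Fin n) ℝ}
    (hQ : ∀ i j, 0 ≤ Q i j) (hs : ∀ i j, Summable fun k => (Q ^ k) i j) :
    HasSum (fun k : ℕ => (Q ^ (k + 1)).trace / (k + 1)) (-Real.log (1 - Q).det) := by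
  have hsum : Summable fun k : ℕ => (Q ^ (k + 1)).trace / (k + 1) := by
    have htr0 : ∀ k, 0 ≤ (Q ^ k).trace := fun k =>
      Finset.sum_nonneg fun i _ => pow_apply_nonneg hQ k i i
    refine Summable.of_nonneg_of_le (fun k => div_nonneg (htr0 _) (by positivity))
      (fun k => div_le_self (htr0 _) ?_)
      ((summable_nat_add_iff (f := fun k => (Q ^ k).trace) 1).2 (summable_trace_pow hs))
    linarith [(Nat.cast_nonneg k : (0 : ℝ) ≤ k)]
  have h := det_one_sub_mul_exp_tsum hQ hs
  have h2 : (1 - Q).det = Real.exp (-∑' k : ℕ, (Q ^ (k + 1)).trace / (k + 1)) := by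
    rw [Real.exp_neg]
    exact eq_inv_of_mul_eq_one_left h
  rw [h2, Real.log_exp, neg_neg]
  exact hsum.hasSum

end Matrix

/-! ### Consequences of the M-matrix property -/

namespace IsNonsingularMMatrix

variable {n : ℕ} {A : Matrix (Fin n) (Fin n) ℝ}

/-- In `1 = ∑ j, A i j * A⁻¹ j i` every term with `j ≠ i` is nonpositive. -/
theorem diag_pos (hA : IsNonsingularMMatrix A) (i : Fin n) : 0 < A i i := by
  have h : (A * A⁻¹) i i = 1 := by rw [Matrix.mul_nonsing_inv _ hA.isUnit_det, Matrix.one_apply_eq]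
  rw [Matrix.mul_apply, ← Finset.add_sum_erase _ _ (Finset.mem_univ i)] at h
  have h2 : ∑ j ∈ Finset.univ.erase i, A i j * A⁻¹ j i ≤ 0 :=
    Finset.sum_nonpos fun j hj => mul_nonpos_of_nonpos_of_nonneg
      (hA.offDiag_nonpos i j (Finset.ne_of_mem_erase hj).symm) (hA.inv_nonneg j i)
  have h3 : 0 < A i i * A⁻¹ i i := by linarith
  exact pos_of_mul_pos_left h3 (hA.inv_nonneg i i)

theorem transpose (hA : IsNonsingularMMatrix A) : IsNonsingularMMatrix A.transpose where
  offDiag_nonpos i j hij := hA.offDiag_nonpos j i hij.symm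
  isUnit_det := by rw [Matrix.det_transpose]; exact hA.isUnit_det
  inv_nonneg i j := by rw [← Matrix.transpose_nonsing_inv]; exact hA.inv_nonneg j i

end IsNonsingularMMatrix

section OffDiag

variable {n : ℕ} {A : Matrix (Fin n) (Fin n) ℝ}

theorem offDiagPart_apply (A : Matrix (Fin n) (Fin n) ℝ) (i j : Fin n) :
    offDiagPart A i j = if i = j then 0 else -A i j := by
  by_cases h : i = j
  · subst h; simp [offDiagPart, diagPart]
  · simp [offDiagPart, diagPart, h]

theorem IsNonsingularMMatrix.offDiagPart_nonneg (hA : IsNonsingularMMatrix A) (i j : Fin n) :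
    0 ≤ offDiagPart A i j := by
  rw [offDiagPart_apply]
  split_ifs with h
  · exact le_rfl
  · linarith [hA.offDiag_nonpos i j h]

theorem offDiagPart_transpose (A : Matrix (Fin n) (Fin n) ℝ) :
    offDiagPart A.transpose = (offDiagPart A).transpose := by
  ext i j
  simp [offDiagPart_apply, eq_comm]

/-- The Neumann series of `(D + S)⁻¹ B` converges for every nonnegative diagonal matrix `S`: its
partial sums for `S = 0` are dominated by the nonnegative matrix `A⁻¹ D`. -/
theorem IsNonsingularMMatrix.summable_pow_apply (hA : IsNonsingularMMatrix A) {s : Fin n → ℝ}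
    (hs : ∀ i, 0 ≤ s i) (i j : Fin n) :
    Summable fun k => ((Matrix.diagonal (fun i => (A i i + s i)⁻¹) * offDiagPart A) ^ k) i j := by
  have hd := hA.diag_pos
  have hB := hA.offDiagPart_nonneg
  have h0 : ∀ i j, 0 ≤ (Matrix.diagonal (fun i => (A i i + s i)⁻¹) * offDiagPart A) i j :=
    fun i j => by
      rw [Matrix.diagonal_mul]
      exact mul_nonneg (_root_.inv_nonneg.2 (add_nonneg (hd i).le (hs i))) (hB i j)
  refine Summable.of_nonneg_of_le (fun k => Matrix.pow_apply_nonneg h0 k i j)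
    (fun k => Matrix.pow_apply_le_pow_apply
      (Q := Matrix.diagonal (fun i => (A i i)⁻¹) * offDiagPart A) h0 (fun i j => ?_) k i j)
    (Matrix.summable_pow_apply_of_one_sub_mul_eq_one
      (N := A⁻¹ * Matrix.diagonal (fun i => A i i)) (fun i j => ?_) (fun i j => ?_) ?_ i j)
  · rw [Matrix.diagonal_mul, Matrix.diagonal_mul]
    exact mul_le_mul_of_nonneg_right
      (inv_anti₀ (hd i) (le_add_of_nonneg_right (hs i))) (hB i j)
  · rw [Matrix.diagonal_mul]
    exact mul_nonneg (_root_.inv_nonneg.2 (hd i).le) (hB i j)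
  · rw [Matrix.mul_diagonal]
    exact mul_nonneg (hA.inv_nonneg i j) (hd j).le
  · have hD : Matrix.diagonal (fun i => (A i i)⁻¹) * Matrix.diagonal (fun i => A i i) = 1 := by
      rw [Matrix.diagonal_mul_diagonal, ← Matrix.diagonal_one]
      congr 1
      ext i
      exact inv_mul_cancel₀ (hd i).ne'
    have h1 : 1 - Matrix.diagonal (fun i => (A i i)⁻¹) * offDiagPart A =
        Matrix.diagonal (fun i => (A i i)⁻¹) * A := by
      rw [← hD, ← mul_sub]
      congr 1
      exact sub_sub_cancel _ A
    rw [h1, mul_assoc, ← mul_assoc A, Matrix.mul_nonsing_inv _ hA.isUnit_det, one_mul, hD]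

end OffDiag

/-! ### Path sums and their symmetrization -/

section PathMatrix

variable {n : ℕ}

/-- The matrix `(c i * B i j) • X i` of linear monomials. Evaluated at a point `t` it is
`diag (c i * t i) * B`, and the coefficients of its powers are sums of weights of paths, collected
according to the number of visits to each index. -/
noncomputable def pathMatrix (c : Fin n → ℝ) (B : Matrix (Fin n) (Fin n) ℝ) :
    Matrix (Fin n) (Fin n) (MvPolynomial (Fin n) ℝ) :=
  Matrix.of fun i j => MvPolynomial.X i * MvPolynomial.C (c i * B i j)

variable {c : Fin n → ℝ} {B : Matrix (Fin n) (Fin n) ℝ}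

theorem coeff_pathMatrix_pow_succ (c : Fin n → ℝ) (B : Matrix (Fin n) (Fin n) ℝ) (k : ℕ)
    (m : Fin n →₀ ℕ) (i j : Fin n) :
    ((pathMatrix c B ^ (k + 1)) i j).coeff m = if i ∈ m.support then
      ∑ l, c i * B i l * ((pathMatrix c B ^ k) l j).coeff (m - Finsupp.single i 1) else 0 := by
  rw [pow_succ', Matrix.mul_apply, MvPolynomial.coeff_sum]
  simp only [pathMatrix, Matrix.of_apply, mul_assoc (MvPolynomial.X i), MvPolynomial.coeff_X_mul',
    MvPolynomial.coeff_C_mul]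
  split_ifs <;> simp

theorem coeff_pathMatrix_pow_nonneg (hc : ∀ i, 0 ≤ c i) (hB : ∀ i j, 0 ≤ B i j) (k : ℕ)
    (m : Fin n →₀ ℕ) (i j : Fin n) : 0 ≤ ((pathMatrix c B ^ k) i j).coeff m := by
  classical
  induction k generalizing m i j with
  | zero =>
    rw [pow_zero, Matrix.one_apply]
    split_ifs
    · rw [MvPolynomial.coeff_one]; split_ifs <;> norm_num
    · simp
  | succ k ih =>
    rw [coeff_pathMatrix_pow_succ]
    split_ifs
    · exact Finset.sum_nonneg fun l _ => mul_nonneg (mul_nonneg (hc i) (hB i l)) (ih _ _ _)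
    · exact le_rfl

theorem geomSymm_nonneg (B : Matrix (Fin n) (Fin n) ℝ) (i j : Fin n) : 0 ≤ geomSymm B i j :=
  Real.sqrt_nonneg _

/-- Reversing a path replaces `B` by its transpose, and the weight of a path under `geomSymm B` is
the geometric mean of its weights under `B` and `Bᵀ`; the Cauchy-Schwarz inequality passes this on
to the path sums. -/
theorem coeff_pathMatrix_geomSymm_pow_le_sqrt (hc : ∀ i, 0 ≤ c i) (hB : ∀ i j, 0 ≤ B i j) (k : ℕ)
    (m : Fin n →₀ ℕ) (i j : Fin n) :
    ((pathMatrix c (geomSymm B) ^ k) i j).coeff m ≤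
      √(((pathMatrix c B ^ k) i j).coeff m) * √(((pathMatrix c B.transpose ^ k) i j).coeff m) := by
  classical
  have hBt : ∀ i j, 0 ≤ B.transpose i j := fun i j => hB j i
  induction k generalizing m i j with
  | zero =>
    rw [← Real.sqrt_mul (by simpa using coeff_pathMatrix_pow_nonneg hc hB 0 m i j), pow_zero,
      pow_zero, pow_zero, Real.sqrt_mul_self]
    simpa using coeff_pathMatrix_pow_nonneg hc hB 0 m i j
  | succ k ih =>
    simp only [coeff_pathMatrix_pow_succ]
    split_ifs
    · set x := fun l => ((pathMatrix c B ^ k) l j).coeff (m - Finsupp.single i 1) with hx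
      set y := fun l => ((pathMatrix c B.transpose ^ k) l j).coeff (m - Finsupp.single i 1) with hy
      have hx0 : ∀ l, 0 ≤ x l := fun l => coeff_pathMatrix_pow_nonneg hc hB k _ l j
      have hy0 : ∀ l, 0 ≤ y l := fun l => coeff_pathMatrix_pow_nonneg hc hBt k _ l j
      refine le_trans (Finset.sum_le_sum fun l _ => ?_)
        (Real.sum_sqrt_mul_sqrt_le Finset.univ (f := fun l => c i * B i l * x l)
          (g := fun l => c i * B.transpose i l * y l)
          (fun l => mul_nonneg (mul_nonneg (hc i) (hB i l)) (hx0 l))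
          (fun l => mul_nonneg (mul_nonneg (hc i) (hBt i l)) (hy0 l)))
      calc c i * geomSymm B i l * _ ≤ c i * geomSymm B i l * (√(x l) * √(y l)) :=
            mul_le_mul_of_nonneg_left (ih _ l j) (mul_nonneg (hc i) (geomSymm_nonneg B i l))
        _ = (√(c i) * √(c i)) * (√(B i l) * √(B l i)) * (√(x l) * √(y l)) := by
            rw [Real.mul_self_sqrt (hc i), ← Real.sqrt_mul (hB i l)]; rfl
        _ = √(c i * B i l * x l) * √(c i * B.transpose i l * y l) := by
            rw [Real.sqrt_mul (mul_nonneg (hc i) (hB i l)), Real.sqrt_mul (hc i),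
              Real.sqrt_mul (mul_nonneg (hc i) (hBt i l)), Real.sqrt_mul (hc i),
              Matrix.transpose_apply]
            ring
    · simp

theorem two_mul_coeff_pathMatrix_geomSymm_pow_le (hc : ∀ i, 0 ≤ c i) (hB : ∀ i j, 0 ≤ B i j)
    (k : ℕ) (m : Fin n →₀ ℕ) (i j : Fin n) :
    2 * ((pathMatrix c (geomSymm B) ^ k) i j).coeff m ≤
      ((pathMatrix c B ^ k) i j).coeff m + ((pathMatrix c B.transpose ^ k) i j).coeff m := by
  have h := coeff_pathMatrix_geomSymm_pow_le_sqrt hc hB k m i j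
  have hx := Real.sq_sqrt (coeff_pathMatrix_pow_nonneg hc hB k m i j)
  have hy := Real.sq_sqrt (coeff_pathMatrix_pow_nonneg (B := B.transpose) hc
    (fun i j => hB j i) k m i j)
  have := two_mul_le_add_sq (√(((pathMatrix c B ^ k) i j).coeff m))
    (√(((pathMatrix c B.transpose ^ k) i j).coeff m))
  linarith

theorem trace_pathMatrix_transpose_pow (c : Fin n → ℝ) (B : Matrix (Fin n) (Fin n) ℝ) (k : ℕ) :
    (pathMatrix c B.transpose ^ k).trace = (pathMatrix c B ^ k).trace := by
  set Y : Matrix (Fin n) (Fin n) (MvPolynomial (Fin n) ℝ) :=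
    Matrix.diagonal fun i => MvPolynomial.X i * MvPolynomial.C (c i) with hY
  set M : Matrix (Fin n) (Fin n) (MvPolynomial (Fin n) ℝ) := B.map MvPolynomial.C with hM
  have h1 : pathMatrix c B = Y * M := by
    ext1 i j
    rw [hY, Matrix.diagonal_mul, hM, Matrix.map_apply, mul_assoc, ← map_mul]
    rfl
  have h2 : pathMatrix c B.transpose = (M * Y).transpose := by
    ext1 i j
    rw [Matrix.transpose_apply, hY, Matrix.mul_diagonal, hM, Matrix.map_apply, mul_comm, mul_assoc,
      ← map_mul]
    rfl
  rw [h1, h2, ← Matrix.transpose_pow, Matrix.trace_transpose]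
  cases k with
  | zero => simp
  | succ k =>
    rw [pow_succ, ← mul_assoc, mul_pow_mul, Matrix.trace_mul_comm, ← mul_assoc, pow_succ,
      Matrix.trace_mul_comm]

theorem coeff_trace (M : Matrix (Fin n) (Fin n) (MvPolynomial (Fin n) ℝ)) (m : Fin n →₀ ℕ) :
    M.trace.coeff m = ∑ i, (M i i).coeff m := by
  rw [Matrix.trace, MvPolynomial.coeff_sum]; rfl

theorem coeff_trace_pathMatrix_pow_nonneg (hc : ∀ i, 0 ≤ c i) (hB : ∀ i j, 0 ≤ B i j)
    (k : ℕ) (m : Fin n →₀ ℕ) : 0 ≤ (pathMatrix c B ^ k).trace.coeff m := by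
  rw [coeff_trace]
  exact Finset.sum_nonneg fun i _ => coeff_pathMatrix_pow_nonneg hc hB k m i i

/-- Closed paths contribute to the trace together with their reversals, so here the arithmetic mean
of the path sums for `B` and `Bᵀ` is the path sum for `B` alone. -/
theorem coeff_trace_pathMatrix_geomSymm_pow_le (hc : ∀ i, 0 ≤ c i) (hB : ∀ i j, 0 ≤ B i j)
    (k : ℕ) (m : Fin n →₀ ℕ) :
    (pathMatrix c (geomSymm B) ^ k).trace.coeff m ≤ (pathMatrix c B ^ k).trace.coeff m := by
  have h : 2 * (pathMatrix c (geomSymm B) ^ k).trace.coeff m ≤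
      (pathMatrix c B ^ k).trace.coeff m + (pathMatrix c B.transpose ^ k).trace.coeff m := by
    simp only [coeff_trace, Finset.mul_sum]
    rw [← Finset.sum_add_distrib]
    exact Finset.sum_le_sum fun i _ => two_mul_coeff_pathMatrix_geomSymm_pow_le hc hB k m i i
  rw [trace_pathMatrix_transpose_pow] at h
  linarith

theorem mapMatrix_eval_pathMatrix_pow (t c : Fin n → ℝ) (B : Matrix (Fin n) (Fin n) ℝ) (k : ℕ) :
    (MvPolynomial.eval t).mapMatrix (pathMatrix c B ^ k) =
      (Matrix.diagonal (fun i => c i * t i) * B) ^ k := by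
  rw [map_pow]
  congr 1
  ext i j
  simp [pathMatrix, Matrix.diagonal_mul]
  ring

theorem eval_pathMatrix_pow (t c : Fin n → ℝ) (B : Matrix (Fin n) (Fin n) ℝ) (k : ℕ)
    (i j : Fin n) : MvPolynomial.eval t ((pathMatrix c B ^ k) i j) =
      ((Matrix.diagonal (fun i => c i * t i) * B) ^ k) i j := by
  rw [← mapMatrix_eval_pathMatrix_pow]; rfl

theorem eval_trace_pathMatrix_pow (t c : Fin n → ℝ) (B : Matrix (Fin n) (Fin n) ℝ) (k : ℕ) :
    MvPolynomial.eval t (pathMatrix c B ^ k).trace =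
      ((Matrix.diagonal (fun i => c i * t i) * B) ^ k).trace := by
  rw [← mapMatrix_eval_pathMatrix_pow, Matrix.trace, map_sum]; rfl

theorem eval_le_eval_of_coeff_le {p q : MvPolynomial (Fin n) ℝ} {t : Fin n → ℝ}
    (ht : ∀ i, 0 ≤ t i) (h : ∀ m, p.coeff m ≤ q.coeff m) :
    MvPolynomial.eval t p ≤ MvPolynomial.eval t q := by
  classical
  have key : ∀ r : MvPolynomial (Fin n) ℝ, r.support ⊆ p.support ∪ q.support →
      MvPolynomial.eval t r = ∑ m ∈ p.support ∪ q.support, r.coeff m * ∏ i, t i ^ m i := by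
    intro r hr
    rw [MvPolynomial.eval_eq']
    refine Finset.sum_subset hr fun m _ hm => ?_
    rw [MvPolynomial.notMem_support_iff.1 hm, zero_mul]
  rw [key p Finset.subset_union_left, key q Finset.subset_union_right]
  exact Finset.sum_le_sum fun m _ => mul_le_mul_of_nonneg_right (h m)
    (Finset.prod_nonneg fun i _ => pow_nonneg (ht i) _)

theorem geomSymm_diagonal_mul_pow_apply_le {c : Fin n → ℝ} (hc : ∀ i, 0 ≤ c i)
    (hB : ∀ i j, 0 ≤ B i j) (k : ℕ) (i j : Fin n) :
    2 * ((Matrix.diagonal c * geomSymm B) ^ k) i j ≤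
      ((Matrix.diagonal c * B) ^ k) i j + ((Matrix.diagonal c * B.transpose) ^ k) i j := by
  have h := eval_le_eval_of_coeff_le (t := fun _ : Fin n => (1 : ℝ))
    (p := MvPolynomial.C 2 * (pathMatrix c (geomSymm B) ^ k) i j)
    (q := (pathMatrix c B ^ k) i j + (pathMatrix c B.transpose ^ k) i j)
    (fun _ => zero_le_one) fun m => by
      rw [MvPolynomial.coeff_C_mul, MvPolynomial.coeff_add]
      exact two_mul_coeff_pathMatrix_geomSymm_pow_le hc hB k m i j
  simpa only [map_mul, map_add, MvPolynomial.eval_C, eval_pathMatrix_pow, mul_one] using h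

end PathMatrix

/-- The Neumann series also converges for the symmetrized matrix, whose powers are dominated by the
means of those for `A` and for the M-matrix `Aᵀ`. -/
theorem IsNonsingularMMatrix.summable_geomSymm_pow_apply {n : ℕ} {A : Matrix (Fin n) (Fin n) ℝ}
    (hA : IsNonsingularMMatrix A) {s : Fin n → ℝ} (hs : ∀ i, 0 ≤ s i) (i j : Fin n) :
    Summable fun k => ((Matrix.diagonal (fun i => (A i i + s i)⁻¹) *
      geomSymm (offDiagPart A)) ^ k) i j := by
  have hc : ∀ i, 0 ≤ (A i i + s i)⁻¹ := fun i =>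
    _root_.inv_nonneg.2 (add_nonneg (hA.diag_pos i).le (hs i))
  have h1 := hA.summable_pow_apply hs i j
  have h2 := hA.transpose.summable_pow_apply hs i j
  rw [offDiagPart_transpose] at h2
  refine Summable.of_nonneg_of_le (fun k => Matrix.pow_apply_nonneg (fun i j => ?_) k i j)
    (fun k => ?_) (h1.add h2)
  · rw [Matrix.diagonal_mul]
    exact mul_nonneg (hc i) (geomSymm_nonneg _ i j)
  · have h3 := geomSymm_diagonal_mul_pow_apply_le hc hA.offDiagPart_nonneg k i j
    have h4 := Matrix.pow_apply_nonneg (A := Matrix.diagonal (fun i => (A i i + s i)⁻¹) *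
      geomSymm (offDiagPart A)) (fun i j => by
        rw [Matrix.diagonal_mul]; exact mul_nonneg (hc i) (geomSymm_nonneg _ i j)) k i j
    simp only [Matrix.transpose_apply]
    linarith

/-! ### Laplace transforms of measures on the nonnegative orthant -/

section Laplace

variable {n : ℕ}

/-- The Laplace transform of a measure on the nonnegative orthant. -/
noncomputable def laplaceTransform (ν : Measure (Fin n → ℝ≥0)) (s : Fin n → ℝ) : ℝ≥0∞ :=
  ∫⁻ x, ENNReal.ofReal (Real.exp (-∑ i, s i * x i)) ∂ν

theorem measurable_laplace_kernel (s : Fin n → ℝ) :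
    Measurable fun x : Fin n → ℝ≥0 => ENNReal.ofReal (Real.exp (-∑ i, s i * x i)) := by
  fun_prop

theorem laplaceTransform_zero (ν : Measure (Fin n → ℝ≥0)) : laplaceTransform ν 0 = ν Set.univ := by
  simp [laplaceTransform]

/-- The function `exp (-⟨s, x⟩)` on the nonnegative orthant, for an exponent `s ≥ 0`. -/
noncomputable def expBCF (s : Fin n → ℝ≥0) : (Fin n → ℝ≥0) →ᵇ ℝ :=
  BoundedContinuousFunction.ofNormedAddCommGroup
    (fun x => Real.exp (-∑ i, (s i : ℝ) * x i)) (by fun_prop) 1 fun x => by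
      rw [Real.norm_eq_abs, Real.abs_exp, Real.exp_le_one_iff, neg_nonpos]
      positivity

theorem expBCF_apply (s x : Fin n → ℝ≥0) :
    expBCF s x = Real.exp (-∑ i, (s i : ℝ) * x i) := rfl

/-- The exponentials `exp (-⟨s, ·⟩)` form a monoid under multiplication. -/
noncomputable def expSubmonoid (n : ℕ) : Submonoid ((Fin n → ℝ≥0) →ᵇ ℝ) where
  carrier := Set.range expBCF
  one_mem' := ⟨0, by ext x; simp [expBCF_apply]⟩
  mul_mem' := by
    rintro _ _ ⟨s, rfl⟩ ⟨t, rfl⟩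
    refine ⟨s + t, ?_⟩
    ext x
    simp [expBCF_apply, ← Real.exp_add, add_mul, Finset.sum_add_distrib]
    ring

/-- A finite measure on the nonnegative orthant is determined by its Laplace transform: by the
Stone-Weierstrass theorem, as the exponentials span an algebra that separates points. -/
theorem ext_of_laplaceTransform_eq {μ ν : Measure (Fin n → ℝ≥0)} [IsFiniteMeasure μ]
    [IsFiniteMeasure ν]
    (h : ∀ s : Fin n → ℝ, (∀ i, 0 ≤ s i) → laplaceTransform μ s = laplaceTransform ν s) :
    μ = ν := by
  let S : StarSubalgebra ℝ ((Fin n → ℝ≥0) →ᵇ ℝ) :=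
    { Algebra.adjoin ℝ (expSubmonoid n : Set ((Fin n → ℝ≥0) →ᵇ ℝ)) with
      star_mem' := fun {a} ha => by
        have : star a = a := by ext x; simp
        rw [this]; exact ha }
  have hint : ∀ s : Fin n → ℝ≥0, ∫ x, expBCF s x ∂μ = ∫ x, expBCF s x ∂ν := by
    intro s
    have key : ∀ ρ : Measure (Fin n → ℝ≥0), ∫ x, expBCF s x ∂ρ =
        (laplaceTransform ρ fun i => (s i : ℝ)).toReal := fun ρ =>
      integral_eq_lintegral_of_nonneg_ae (Eventually.of_forall fun x => (Real.exp_pos _).le)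
        (expBCF s).continuous.aestronglyMeasurable
    rw [key, key, h (fun i => (s i : ℝ)) fun i => (s i).2]
  refine ext_of_forall_mem_subalgebra_integral_eq_of_pseudoEMetric_complete_countable
    (𝕜 := ℝ) (A := S) ?_ ?_
  · intro x y hxy
    obtain ⟨i, hi⟩ := Function.ne_iff.1 hxy
    refine ⟨expBCF (Pi.single i 1), ⟨BoundedContinuousFunction.toContinuousMapStarₐ ℝ
      (expBCF (Pi.single i 1)), ⟨_, Algebra.subset_adjoin ⟨_, rfl⟩, rfl⟩, rfl⟩, ?_⟩
    have key : ∀ z : Fin n → ℝ≥0, expBCF (Pi.single i 1) z = Real.exp (-(z i : ℝ)) := by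
      intro z
      rw [expBCF_apply, Finset.sum_eq_single i (fun j _ hj => by simp [hj]) (by simp)]
      simp
    rw [key, key]
    intro he
    exact hi (NNReal.coe_injective (neg_injective (Real.exp_injective he)))
  · intro g hg
    have hg' : g ∈ Submodule.span ℝ (expSubmonoid n : Set ((Fin n → ℝ≥0) →ᵇ ℝ)) := by
      have : g ∈ Subalgebra.toSubmodule
          (Algebra.adjoin ℝ (expSubmonoid n : Set ((Fin n → ℝ≥0) →ᵇ ℝ))) := hg
      rwa [Algebra.adjoin_eq_span, Submonoid.closure_eq] at this
    clear hg
    induction hg' using Submodule.span_induction with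
    | mem g hg => obtain ⟨s, rfl⟩ := hg; exact hint s
    | zero => simp
    | add f g hf hg ihf ihg =>
      simp only [BoundedContinuousFunction.coe_add, Pi.add_apply]
      rw [integral_add (f.integrable μ) (g.integrable μ),
        integral_add (f.integrable ν) (g.integrable ν), ihf, ihg]
    | smul a f hf ih =>
      simp only [BoundedContinuousFunction.coe_smul, smul_eq_mul]
      rw [integral_const_mul, integral_const_mul, ih]

/-- A measure on `ℝⁿ` whose Laplace transform on the nonnegative orthant is finite and agrees with
that of a measure on the orthant is carried by the orthant: `∫ exp (-r xᵢ)` stays bounded as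
`r → ∞`. -/
theorem ae_nonneg_of_laplaceTransform_eq {μ : Measure (Fin n → ℝ)} {ν : Measure (Fin n → ℝ≥0)}
    [IsFiniteMeasure ν]
    (h : ∀ s : Fin n → ℝ, (∀ i, 0 ≤ s i) →
      ∫⁻ x, ENNReal.ofReal (Real.exp (-∑ i, s i * x i)) ∂μ = laplaceTransform ν s) :
    ∀ᵐ x ∂μ, ∀ i, 0 ≤ x i := by
  rw [ae_all_iff]
  intro i
  have hbound : ∀ r : ℕ, ∫⁻ x, ENNReal.ofReal (Real.exp (-(r * x i))) ∂μ ≤ ν Set.univ := by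
    intro r
    have h1 := h (Pi.single i (r : ℝ)) fun j => by
      by_cases hj : j = i
      · subst hj; simp
      · simp [hj]
    have h2 : ∀ x : Fin n → ℝ, ∑ j, (Pi.single i (r : ℝ) : Fin n → ℝ) j * x j = r * x i := by
      intro x
      rw [Finset.sum_eq_single i (fun j _ hj => by simp [hj]) (by simp)]
      simp
    simp only [h2] at h1
    rw [h1, laplaceTransform, ← lintegral_one]
    refine lintegral_mono fun x => ?_
    rw [h2 fun i => (x i : ℝ)]
    rw [ENNReal.ofReal_le_one, Real.exp_le_one_iff, neg_nonpos]
    positivity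
  -- on `{x i ≤ -1 / (m + 1)}` the integrand with `r = (m + 1) * k` is at least `k`
  have hm : ∀ m : ℕ, μ {x | x i ≤ -(1 / ((m : ℝ) + 1))} = 0 := by
    intro m
    by_contra hne
    have hk : ∀ k : ℕ, (k : ℝ≥0∞) * μ {x | x i ≤ -(1 / ((m : ℝ) + 1))} ≤ ν Set.univ := by
      intro k
      refine le_trans ?_ (hbound ((m + 1) * k))
      have hms : MeasurableSet {x : Fin n → ℝ | x i ≤ -(1 / ((m : ℝ) + 1))} :=
        measurableSet_le (measurable_pi_apply i) measurable_const
      rw [← setLIntegral_const]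
      refine le_trans (setLIntegral_mono' hms fun x hx => ?_) (setLIntegral_le_lintegral _ _)
      rw [← ENNReal.ofReal_natCast k]
      refine ENNReal.ofReal_le_ofReal ?_
      have hx' : x i ≤ -(1 / ((m : ℝ) + 1)) := hx
      have h3 : (k : ℝ) ≤ -((((m + 1) * k : ℕ) : ℝ) * x i) := by
        push_cast
        have hp : (0 : ℝ) < m + 1 := by positivity
        have : ((m : ℝ) + 1) * k * x i ≤ ((m : ℝ) + 1) * k * -(1 / ((m : ℝ) + 1)) :=
          mul_le_mul_of_nonneg_left hx' (by positivity)
        have h4 : ((m : ℝ) + 1) * k * -(1 / ((m : ℝ) + 1)) = -k := by field_simp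
        linarith
      linarith [Real.add_one_le_exp (-((((m + 1) * k : ℕ) : ℝ) * x i))]
    have hfin : μ {x | x i ≤ -(1 / ((m : ℝ) + 1))} ≠ ∞ := by
      have := hk 1
      rw [Nat.cast_one, one_mul] at this
      exact ne_top_of_le_ne_top (measure_ne_top ν _) this
    obtain ⟨k, hk'⟩ := ENNReal.exists_nat_mul_gt hne (measure_ne_top ν Set.univ)
    exact absurd (hk k) (not_le.2 hk')
  rw [ae_iff]
  refine measure_mono_null (t := ⋃ m : ℕ, {x | x i ≤ -(1 / ((m : ℝ) + 1))}) (fun x hx => ?_)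
    (measure_iUnion_null hm)
  have hx' : x i < 0 := not_le.1 hx
  obtain ⟨m, hm⟩ := exists_nat_one_div_lt (neg_pos.2 hx')
  exact Set.mem_iUnion.2 ⟨m, show x i ≤ -(1 / ((m : ℝ) + 1)) by linarith⟩

/-- The inclusion of the nonnegative orthant into `ℝⁿ`. -/
def orthantCoe (n : ℕ) (x : Fin n → ℝ≥0) : Fin n → ℝ := fun i => x i

theorem measurable_orthantCoe : Measurable (orthantCoe n) := by
  unfold orthantCoe; fun_prop

theorem eq_map_orthantCoe_of_laplaceTransform_eq {μ : Measure (Fin n → ℝ)}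
    {ν : Measure (Fin n → ℝ≥0)} [IsFiniteMeasure μ] [IsFiniteMeasure ν]
    (h : ∀ s : Fin n → ℝ, (∀ i, 0 ≤ s i) →
      ∫⁻ x, ENNReal.ofReal (Real.exp (-∑ i, s i * x i)) ∂μ = laplaceTransform ν s) :
    μ = ν.map (orthantCoe n) := by
  have hae := ae_nonneg_of_laplaceTransform_eq h
  have hmeas : Measurable fun (x : Fin n → ℝ) (i : Fin n) => (x i).toNNReal := by fun_prop
  have hν : μ.map (fun (x : Fin n → ℝ) (i : Fin n) => (x i).toNNReal) = ν := by
    refine ext_of_laplaceTransform_eq fun s hs => ?_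
    rw [← h s hs, laplaceTransform, lintegral_map (measurable_laplace_kernel s) hmeas]
    refine lintegral_congr_ae ?_
    filter_upwards [hae] with x hx
    simp only [Real.coe_toNNReal _ (hx _)]
  rw [← hν, Measure.map_map measurable_orthantCoe hmeas]
  conv_lhs => rw [← Measure.map_id (μ := μ)]
  refine Measure.map_congr ?_
  filter_upwards [hae] with x hx
  ext i
  exact (Real.coe_toNNReal _ (hx i)).symm

end Laplace

/-! ### Gamma distributions, their mixtures and convolution exponentials -/

section Gamma

/-- The gamma distribution with shape `a` and rate `r` as a measure on `[0, ∞)`; for shape `0` it is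
the unit mass at the origin. -/
noncomputable def gammaNNReal (a r : ℝ) : Measure ℝ≥0 :=
  if a = 0 then Measure.dirac 0 else (ProbabilityTheory.gammaMeasure a r).map Real.toNNReal

theorem isProbabilityMeasure_gammaNNReal {a r : ℝ} (ha : 0 ≤ a) (hr : 0 < r) :
    IsProbabilityMeasure (gammaNNReal a r) := by
  unfold gammaNNReal
  split_ifs with h
  · infer_instance
  · have := ProbabilityTheory.isProbabilityMeasure_gammaMeasure (lt_of_le_of_ne ha (Ne.symm h)) hr
    exact Measure.isProbabilityMeasure_map (by fun_prop)

theorem lintegral_exp_gammaNNReal {a r s : ℝ} (ha : 0 ≤ a) (hr : 0 < r) (hs : 0 ≤ s) :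
    ∫⁻ x : ℝ≥0, ENNReal.ofReal (Real.exp (-(s * x))) ∂gammaNNReal a r =
      ENNReal.ofReal ((r / (r + s)) ^ a) := by
  unfold gammaNNReal
  split_ifs with h
  · subst h
    rw [lintegral_dirac' _ (by fun_prop)]
    simp
  · have ha' : 0 < a := lt_of_le_of_ne ha (Ne.symm h)
    have hrs : 0 < r + s := by linarith
    have hpdf : Measurable (ProbabilityTheory.gammaPDF a r) :=
      (ProbabilityTheory.measurable_gammaPDFReal a r).ennreal_ofReal
    rw [lintegral_map (by fun_prop) (by fun_prop), ProbabilityTheory.gammaMeasure,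
      lintegral_withDensity_eq_lintegral_mul _ hpdf (by fun_prop)]
    -- tilting the density by `exp (-s x)` changes the rate to `r + s`
    have key : ∀ x : ℝ, (ProbabilityTheory.gammaPDF a r *
        fun x : ℝ => ENNReal.ofReal (Real.exp (-(s * (x.toNNReal : ℝ))))) x =
        ENNReal.ofReal ((r / (r + s)) ^ a) * ProbabilityTheory.gammaPDF a (r + s) x := by
      intro x
      rw [Pi.mul_apply]
      rcases lt_or_ge x 0 with hx | hx
      · simp [ProbabilityTheory.gammaPDF_of_neg hx]
      · have hp : 0 < (r + s) ^ a := Real.rpow_pos_of_pos hrs a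
        rw [ProbabilityTheory.gammaPDF_of_nonneg hx, ProbabilityTheory.gammaPDF_of_nonneg hx,
          ← ENNReal.ofReal_mul (by positivity), ← ENNReal.ofReal_mul (by positivity),
          Real.coe_toNNReal x hx, Real.div_rpow hr.le hrs.le,
          show -((r + s) * x) = -(r * x) + -(s * x) by ring, Real.exp_add]
        congr 1
        field_simp
    rw [lintegral_congr key, lintegral_const_mul' _ _ ENNReal.ofReal_ne_top,
      ProbabilityTheory.lintegral_gammaPDF_eq_one ha' hrs, mul_one]

variable {n : ℕ}

/-- The product of the gamma distributions with shapes `a i` and rates `d i`. -/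
noncomputable def gammaPi (d a : Fin n → ℝ) : Measure (Fin n → ℝ≥0) :=
  Measure.pi fun i => gammaNNReal (a i) (d i)

theorem isProbabilityMeasure_gammaPi {d a : Fin n → ℝ} (hd : ∀ i, 0 < d i) (ha : ∀ i, 0 ≤ a i) :
    IsProbabilityMeasure (gammaPi d a) := by
  have := fun i => isProbabilityMeasure_gammaNNReal (ha i) (hd i)
  unfold gammaPi
  infer_instance

theorem laplaceTransform_gammaPi {d a s : Fin n → ℝ} (hd : ∀ i, 0 < d i) (ha : ∀ i, 0 ≤ a i)
    (hs : ∀ i, 0 ≤ s i) :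
    laplaceTransform (gammaPi d a) s = ENNReal.ofReal (∏ i, (d i / (d i + s i)) ^ a i) := by
  have := fun i => isProbabilityMeasure_gammaNNReal (ha i) (hd i)
  have hm : ∀ i, Measurable fun x : ℝ≥0 => ENNReal.ofReal (Real.exp (-(s i * x))) := fun i => by
    fun_prop
  have h := ProbabilityTheory.lintegral_prod_eq_prod_lintegral_of_indepFun Finset.univ
    (fun i (x : Fin n → ℝ≥0) => ENNReal.ofReal (Real.exp (-(s i * x i))))
    (ProbabilityTheory.iIndepFun_pi (μ := fun i => gammaNNReal (a i) (d i))
      (X := fun i (x : ℝ≥0) => ENNReal.ofReal (Real.exp (-(s i * x)))) fun i => (hm i).aemeasurable)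
    fun i => (hm i).comp (measurable_pi_apply i)
  rw [laplaceTransform, gammaPi]
  calc _ = ∫⁻ x : Fin n → ℝ≥0, ∏ i, ENNReal.ofReal (Real.exp (-(s i * x i)))
        ∂Measure.pi fun i => gammaNNReal (a i) (d i) := by
        refine lintegral_congr fun x => ?_
        rw [← ENNReal.ofReal_prod_of_nonneg fun i _ => (Real.exp_pos _).le, ← Real.exp_sum,
          Finset.sum_neg_distrib]
    _ = _ := by
        rw [h, ENNReal.ofReal_prod_of_nonneg fun i _ => Real.rpow_nonneg
          (div_nonneg (hd i).le (add_nonneg (hd i).le (hs i))) _]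
        refine Finset.prod_congr rfl fun i _ => ?_
        rw [← lintegral_exp_gammaNNReal (ha i) (hd i) (hs i)]
        exact ((measurePreserving_eval (fun i => gammaNNReal (a i) (d i)) i).lintegral_comp (hm i))

end Gamma

section Mixture

variable {n : ℕ}

theorem laplaceTransform_sum {ι : Type*} (ν : ι → Measure (Fin n → ℝ≥0)) (s : Fin n → ℝ) :
    laplaceTransform (Measure.sum ν) s = ∑' i, laplaceTransform (ν i) s :=
  lintegral_sum_measure _ _

theorem laplaceTransform_smul (c : ℝ≥0∞) (ν : Measure (Fin n → ℝ≥0)) (s : Fin n → ℝ) :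
    laplaceTransform (c • ν) s = c * laplaceTransform ν s :=
  lintegral_smul_measure _ _

theorem laplaceTransform_conv (μ ν : Measure (Fin n → ℝ≥0)) [SFinite ν] (s : Fin n → ℝ) :
    laplaceTransform (μ.conv ν) s = laplaceTransform μ s * laplaceTransform ν s := by
  rw [laplaceTransform, Measure.lintegral_conv (measurable_laplace_kernel s)]
  have h : ∀ x y : Fin n → ℝ≥0, ENNReal.ofReal (Real.exp (-∑ i, s i * ((x + y) i : ℝ≥0))) =
      ENNReal.ofReal (Real.exp (-∑ i, s i * x i)) *
        ENNReal.ofReal (Real.exp (-∑ i, s i * y i)) := by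
    intro x y
    rw [← ENNReal.ofReal_mul (Real.exp_pos _).le, ← Real.exp_add, ← neg_add,
      ← Finset.sum_add_distrib]
    simp [mul_add]
  simp only [h]
  simp only [lintegral_const_mul _ (measurable_laplace_kernel s)]
  rw [lintegral_mul_const _ (measurable_laplace_kernel s)]
  rfl

theorem conv_le_conv {μ μ' ν ν' : Measure (Fin n → ℝ≥0)} [SFinite ν] [SFinite ν']
    (hμ : μ ≤ μ') (hν : ν ≤ ν') : μ.conv ν ≤ μ'.conv ν' := by
  refine Measure.le_iff.2 fun t ht => ?_
  rw [← lintegral_indicator_one ht, ← lintegral_indicator_one ht,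
    Measure.lintegral_conv (measurable_one.indicator ht),
    Measure.lintegral_conv (measurable_one.indicator ht)]
  exact lintegral_mono' hμ fun x => lintegral_mono' hν le_rfl

theorem sum_le_sum_of_le {ι : Type*} {μ ν : ι → Measure (Fin n → ℝ≥0)} (h : ∀ i, μ i ≤ ν i) :
    Measure.sum μ ≤ Measure.sum ν := by
  refine Measure.le_iff.2 fun t ht => ?_
  rw [Measure.sum_apply _ ht, Measure.sum_apply _ ht]
  exact ENNReal.tsum_le_tsum fun i => h i t

/-- The mixture of products of gamma distributions with integral shapes in which the shape `m` has
the weight `p.coeff m`. Its Laplace transform at `s` is `p` evaluated at `d i / (d i + s i)`. -/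
noncomputable def gammaMixture (d : Fin n → ℝ) (p : MvPolynomial (Fin n) ℝ) :
    Measure (Fin n → ℝ≥0) :=
  Measure.sum fun m : Fin n →₀ ℕ => ENNReal.ofReal (p.coeff m) • gammaPi d fun i => (m i : ℝ)

theorem sFinite_gammaMixture {d : Fin n → ℝ} (hd : ∀ i, 0 < d i) (p : MvPolynomial (Fin n) ℝ) :
    SFinite (gammaMixture d p) := by
  have := fun m : Fin n →₀ ℕ => isProbabilityMeasure_gammaPi (a := fun i => (m i : ℝ)) hd
    fun i => Nat.cast_nonneg _
  unfold gammaMixture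
  infer_instance

theorem laplaceTransform_gammaMixture {d s : Fin n → ℝ} (hd : ∀ i, 0 < d i) (hs : ∀ i, 0 ≤ s i)
    {p : MvPolynomial (Fin n) ℝ} (hp : ∀ m, 0 ≤ p.coeff m) :
    laplaceTransform (gammaMixture d p) s =
      ENNReal.ofReal (MvPolynomial.eval (fun i => d i / (d i + s i)) p) := by
  have ht : ∀ i, 0 ≤ d i / (d i + s i) := fun i =>
    div_nonneg (hd i).le (add_nonneg (hd i).le (hs i))
  rw [gammaMixture, laplaceTransform_sum, tsum_eq_sum (s := p.support) fun m hm => by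
    rw [laplaceTransform_smul, MvPolynomial.notMem_support_iff.1 hm, ENNReal.ofReal_zero, zero_mul],
    MvPolynomial.eval_eq', ENNReal.ofReal_sum_of_nonneg fun m _ => mul_nonneg (hp m)
      (Finset.prod_nonneg fun i _ => pow_nonneg (ht i) _)]
  refine Finset.sum_congr rfl fun m _ => ?_
  rw [laplaceTransform_smul, laplaceTransform_gammaPi hd (fun i => Nat.cast_nonneg _) hs,
    ENNReal.ofReal_mul (hp m)]
  simp only [Real.rpow_natCast]

theorem gammaMixture_mono (d : Fin n → ℝ) {p q : MvPolynomial (Fin n) ℝ}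
    (h : ∀ m, p.coeff m ≤ q.coeff m) : gammaMixture d p ≤ gammaMixture d q :=
  sum_le_sum_of_le fun m => Measure.le_iff.2 fun t _ => by
    simp only [Measure.smul_apply, smul_eq_mul]
    gcongr
    exact h m

/-- The measure whose Laplace transform is `-log det (1 - diag (d + s)⁻¹ B)`: the mixture
representation of the series `∑ tr ((diag (d + s)⁻¹ B) ^ k) / k`. -/
noncomputable def logDetMeasure (d : Fin n → ℝ) (B : Matrix (Fin n) (Fin n) ℝ) :
    Measure (Fin n → ℝ≥0) :=
  Measure.sum fun k : ℕ => ENNReal.ofReal ((k + 1 : ℝ)⁻¹) •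
    gammaMixture d (pathMatrix (fun i => (d i)⁻¹) B ^ (k + 1)).trace

theorem sFinite_logDetMeasure {d : Fin n → ℝ} (hd : ∀ i, 0 < d i)
    (B : Matrix (Fin n) (Fin n) ℝ) : SFinite (logDetMeasure d B) := by
  have := fun p => sFinite_gammaMixture hd p
  unfold logDetMeasure
  infer_instance

theorem laplaceTransform_logDetMeasure {d s : Fin n → ℝ} (hd : ∀ i, 0 < d i) (hs : ∀ i, 0 ≤ s i)
    {B : Matrix (Fin n) (Fin n) ℝ} (hB : ∀ i j, 0 ≤ B i j)
    (hsum : ∀ i j, Summable fun k =>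
      ((Matrix.diagonal (fun i => (d i + s i)⁻¹) * B) ^ k) i j) :
    laplaceTransform (logDetMeasure d B) s =
      ENNReal.ofReal (-Real.log (1 - Matrix.diagonal (fun i => (d i + s i)⁻¹) * B).det) := by
  set Q := Matrix.diagonal (fun i => (d i + s i)⁻¹) * B with hQdef
  have hQ : ∀ i j, 0 ≤ Q i j := fun i j => by
    rw [hQdef, Matrix.diagonal_mul]
    exact mul_nonneg (inv_nonneg.2 (add_nonneg (hd i).le (hs i))) (hB i j)
  have htr : ∀ k, 0 ≤ (Q ^ k).trace := fun k =>
    Finset.sum_nonneg fun i _ => Matrix.pow_apply_nonneg hQ k i i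
  have heq : (fun i => (d i)⁻¹ * (d i / (d i + s i))) = fun i => (d i + s i)⁻¹ := by
    ext i
    rw [← mul_div_assoc, inv_mul_cancel₀ (hd i).ne', one_div]
  have hh := Matrix.hasSum_trace_pow_div hQ hsum
  rw [logDetMeasure, laplaceTransform_sum, ← hh.tsum_eq,
    ENNReal.ofReal_tsum_of_nonneg (fun k => div_nonneg (htr _) (by positivity)) hh.summable]
  refine tsum_congr fun k => ?_
  rw [laplaceTransform_smul, laplaceTransform_gammaMixture hd hs fun m =>
    coeff_trace_pathMatrix_pow_nonneg (fun i => inv_nonneg.2 (hd i).le) hB (k + 1) m,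
    eval_trace_pathMatrix_pow, heq, ← ENNReal.ofReal_mul (by positivity), div_eq_inv_mul]

theorem logDetMeasure_geomSymm_le {d : Fin n → ℝ} (hd : ∀ i, 0 < d i)
    {B : Matrix (Fin n) (Fin n) ℝ} (hB : ∀ i j, 0 ≤ B i j) :
    logDetMeasure d (geomSymm B) ≤ logDetMeasure d B :=
  sum_le_sum_of_le fun k => by
    gcongr
    exact gammaMixture_mono d fun m => coeff_trace_pathMatrix_geomSymm_pow_le
      (fun i => inv_nonneg.2 (hd i).le) hB (k + 1) m

/-- The convolution of `μ` with the `k`-th convolution power of `ν`. -/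
noncomputable def convPow (ν μ : Measure (Fin n → ℝ≥0)) : ℕ → Measure (Fin n → ℝ≥0)
  | 0 => μ
  | k + 1 => ν.conv (convPow ν μ k)

theorem sFinite_convPow (ν μ : Measure (Fin n → ℝ≥0)) [SFinite ν] [SFinite μ] (k : ℕ) :
    SFinite (convPow ν μ k) := by
  induction k with
  | zero => assumption
  | succ k ih => unfold convPow; infer_instance

theorem laplaceTransform_convPow (ν μ : Measure (Fin n → ℝ≥0)) [SFinite ν] [SFinite μ] (k : ℕ)
    (s : Fin n → ℝ) : laplaceTransform (convPow ν μ k) s =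
      laplaceTransform ν s ^ k * laplaceTransform μ s := by
  induction k with
  | zero => simp [convPow]
  | succ k ih =>
    have := sFinite_convPow ν μ k
    rw [convPow, laplaceTransform_conv, ih, pow_succ', mul_assoc]

theorem convPow_mono {ν ν' : Measure (Fin n → ℝ≥0)} (μ : Measure (Fin n → ℝ≥0)) [SFinite ν]
    [SFinite ν'] [SFinite μ] (h : ν ≤ ν') (k : ℕ) : convPow ν μ k ≤ convPow ν' μ k := by
  induction k with
  | zero => exact le_rfl
  | succ k ih =>
    have := sFinite_convPow ν μ k
    have := sFinite_convPow ν' μ k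
    exact conv_le_conv h ih

/-- The convolution exponential of `α • logDetMeasure d B`, convolved with a product of gamma
distributions of shape `α`. Up to normalization, this is the law of an `α`-permanental vector. -/
noncomputable def permanentalMeasure (α : ℝ) (d : Fin n → ℝ) (B : Matrix (Fin n) (Fin n) ℝ) :
    Measure (Fin n → ℝ≥0) :=
  Measure.sum fun k : ℕ => ENNReal.ofReal (α ^ k / k.factorial) •
    convPow (logDetMeasure d B) (gammaPi d fun _ => α) k

theorem permanentalMeasure_geomSymm_le {α : ℝ} (hα : 0 < α) {d : Fin n → ℝ} (hd : ∀ i, 0 < d i)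
    {B : Matrix (Fin n) (Fin n) ℝ} (hB : ∀ i j, 0 ≤ B i j) :
    permanentalMeasure α d (geomSymm B) ≤ permanentalMeasure α d B := by
  have := sFinite_logDetMeasure hd B
  have := sFinite_logDetMeasure hd (geomSymm B)
  have := isProbabilityMeasure_gammaPi (a := fun _ => α) hd fun _ => hα.le
  exact sum_le_sum_of_le fun k => by
    gcongr
    exact convPow_mono _ (logDetMeasure_geomSymm_le hd hB) k

theorem laplaceTransform_permanentalMeasure {α : ℝ} (hα : 0 < α) {d s : Fin n → ℝ}
    (hd : ∀ i, 0 < d i) (hs : ∀ i, 0 ≤ s i)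
    {B : Matrix (Fin n) (Fin n) ℝ} (hB : ∀ i j, 0 ≤ B i j)
    (hsum : ∀ i j, Summable fun k =>
      ((Matrix.diagonal (fun i => (d i + s i)⁻¹) * B) ^ k) i j) :
    laplaceTransform (permanentalMeasure α d B) s = ENNReal.ofReal
      ((∏ i, d i / (d i + s i)) ^ α /
        (1 - Matrix.diagonal (fun i => (d i + s i)⁻¹) * B).det ^ α) := by
  have := sFinite_logDetMeasure hd B
  have := isProbabilityMeasure_gammaPi (a := fun _ => α) hd fun _ => hα.le
  set Q := Matrix.diagonal (fun i => (d i + s i)⁻¹) * B with hQdef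
  have hQ : ∀ i j, 0 ≤ Q i j := fun i j => by
    rw [hQdef, Matrix.diagonal_mul]
    exact mul_nonneg (inv_nonneg.2 (add_nonneg (hd i).le (hs i))) (hB i j)
  have hdet := Matrix.det_one_sub_pos hQ hsum
  have hlog : 0 ≤ -Real.log (1 - Q).det := by
    rw [← (Matrix.hasSum_trace_pow_div hQ hsum).tsum_eq]
    exact tsum_nonneg fun k => div_nonneg
      (Finset.sum_nonneg fun i _ => Matrix.pow_apply_nonneg hQ _ i i) (by positivity)
  have ht : ∀ i, 0 ≤ d i / (d i + s i) := fun i =>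
    div_nonneg (hd i).le (add_nonneg (hd i).le (hs i))
  have hexp : HasSum (fun k : ℕ => α ^ k / k.factorial * (-Real.log (1 - Q).det) ^ k)
      (Real.exp (α * -Real.log (1 - Q).det)) := by
    have h := NormedSpace.expSeries_div_hasSum_exp (𝔸 := ℝ) (α * -Real.log (1 - Q).det)
    rw [← Real.exp_eq_exp_ℝ] at h
    refine h.congr_fun fun k => ?_
    rw [mul_pow]; ring
  have hdetα : Real.exp (α * -Real.log (1 - Q).det) = ((1 - Q).det ^ α)⁻¹ := by
    rw [Real.rpow_def_of_pos hdet, ← Real.exp_neg]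
    congr 1; ring
  rw [permanentalMeasure, laplaceTransform_sum]
  simp only [laplaceTransform_smul, laplaceTransform_convPow,
    laplaceTransform_logDetMeasure hd hs hB hsum, ← mul_assoc]
  rw [ENNReal.tsum_mul_right, laplaceTransform_gammaPi hd (fun _ => hα.le) hs,
    Real.finsetProd_rpow _ _ fun i _ => ht i, div_eq_inv_mul,
    ENNReal.ofReal_mul (inv_nonneg.2 (Real.rpow_nonneg hdet.le _)), ← hdetα, ← hexp.tsum_eq,
    ENNReal.ofReal_tsum_of_nonneg (fun k => by positivity) hexp.summable]
  congr 1
  refine tsum_congr fun k => ?_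
  rw [ENNReal.ofReal_mul (by positivity), ENNReal.ofReal_pow hlog]

end Mixture

/-! ### The law of a permanental vector -/

section Law

variable {n : ℕ}

theorem add_diagonal_eq_diagonal_mul {A : Matrix (Fin n) (Fin n) ℝ} (hd : ∀ i, 0 < A i i)
    {s : Fin n → ℝ} (hs : ∀ i, 0 ≤ s i) :
    A + Matrix.diagonal s = Matrix.diagonal (fun i => A i i + s i) *
      (1 - Matrix.diagonal (fun i => (A i i + s i)⁻¹) * offDiagPart A) := by
  rw [mul_sub, mul_one, ← mul_assoc, Matrix.diagonal_mul_diagonal,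
    show (fun i => (A i i + s i) * (A i i + s i)⁻¹) = fun _ => 1 from funext fun i =>
      mul_inv_cancel₀ (add_pos_of_pos_of_nonneg (hd i) (hs i)).ne', Matrix.diagonal_one, one_mul,
    offDiagPart, ← Matrix.diagonal_add]
  change A + Matrix.diagonal s = Matrix.diagonal A.diag + Matrix.diagonal s -
    (Matrix.diagonal A.diag - A)
  abel

theorem barMatrix_eq_one_sub {A : Matrix (Fin n) (Fin n) ℝ} (hd : ∀ i, 0 < A i i) :
    barMatrix A = 1 - Matrix.diagonal (fun i => (A i i)⁻¹) * offDiagPart A := by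
  have hD : (diagPart A)⁻¹ = Matrix.diagonal fun i => (A i i)⁻¹ := by
    refine Matrix.inv_eq_left_inv ?_
    rw [diagPart, Matrix.diagonal_mul_diagonal, ← Matrix.diagonal_one]
    congr 1
    ext i
    exact inv_mul_cancel₀ (hd i).ne'
  have h1 : Matrix.diagonal (fun i => (A i i)⁻¹) * diagPart A = 1 := by
    rw [diagPart, Matrix.diagonal_mul_diagonal, ← Matrix.diagonal_one]
    congr 1
    ext i
    exact inv_mul_cancel₀ (hd i).ne'
  rw [barMatrix, hD, offDiagPart, mul_sub, h1, sub_sub_cancel]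

theorem symMatrix_apply_self (A : Matrix (Fin n) (Fin n) ℝ) (i : Fin n) :
    symMatrix A i i = A i i := by
  simp [symMatrix, diagPart, geomSymm, offDiagPart_apply]

theorem offDiagPart_symMatrix (A : Matrix (Fin n) (Fin n) ℝ) :
    offDiagPart (symMatrix A) = geomSymm (offDiagPart A) := by
  have h : diagPart (symMatrix A) = diagPart A := by
    rw [diagPart, diagPart]
    congr 1
    ext i
    exact symMatrix_apply_self A i
  rw [offDiagPart, h, symMatrix, sub_sub_cancel]

theorem one_div_det_one_add_rpow {A : Matrix (Fin n) (Fin n) ℝ} (hd : ∀ i, 0 < A i i)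
    (hbar : 0 < (barMatrix A).det) (α : ℝ) {s : Fin n → ℝ} (hs : ∀ i, 0 ≤ s i)
    (hdet : 0 < (1 - Matrix.diagonal (fun i => (A i i + s i)⁻¹) * offDiagPart A).det) :
    1 / (1 + A⁻¹ * Matrix.diagonal s).det ^ α = (barMatrix A).det ^ α *
      ((∏ i, A i i / (A i i + s i)) ^ α /
        (1 - Matrix.diagonal (fun i => (A i i + s i)⁻¹) * offDiagPart A).det ^ α) := by
  have hD : 0 < ∏ i, A i i := Finset.prod_pos fun i _ => hd i
  have hDs : 0 < ∏ i, (A i i + s i) :=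
    Finset.prod_pos fun i _ => add_pos_of_pos_of_nonneg (hd i) (hs i)
  have hA : A.det = (∏ i, A i i) * (barMatrix A).det := by
    have h := add_diagonal_eq_diagonal_mul hd (s := 0) fun _ => le_rfl
    simp only [Pi.zero_apply, add_zero] at h
    rw [← barMatrix_eq_one_sub hd] at h
    have h2 := congrArg Matrix.det h
    rw [Matrix.det_mul, Matrix.det_diagonal] at h2
    simpa using h2
  have hA0 : 0 < A.det := by rw [hA]; exact mul_pos hD hbar
  have h1 : (1 + A⁻¹ * Matrix.diagonal s) = A⁻¹ * (A + Matrix.diagonal s) := by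
    rw [mul_add, Matrix.nonsing_inv_mul _ hA0.ne'.isUnit]
  have h2 : (1 + A⁻¹ * Matrix.diagonal s).det = (A.det)⁻¹ * ((∏ i, (A i i + s i)) *
      (1 - Matrix.diagonal (fun i => (A i i + s i)⁻¹) * offDiagPart A).det) := by
    rw [h1, Matrix.det_mul, add_diagonal_eq_diagonal_mul hd hs, Matrix.det_mul,
      Matrix.det_diagonal, Matrix.det_nonsing_inv, Ring.inverse_eq_inv']
  rw [h2, ← Real.div_rpow (by rw [Finset.prod_div_distrib]; positivity) hdet.le,
    ← Real.mul_rpow hbar.le (by rw [Finset.prod_div_distrib]; positivity), one_div,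
    ← Real.inv_rpow (by positivity), hA, Finset.prod_div_distrib]
  congr 1
  field_simp

/-- The law of an `α`-permanental vector with kernel `A⁻¹`, identified through its Laplace
transform. The hypotheses hold both for an M-matrix and for its symmetrization. -/
theorem IsPermanental.map_eq {Ω : Type*} [MeasurableSpace Ω] {P : Measure Ω}
    [IsProbabilityMeasure P] {α : ℝ} (hα : 0 < α) {A : Matrix (Fin n) (Fin n) ℝ}
    (hd : ∀ i, 0 < A i i) (hB : ∀ i j, 0 ≤ offDiagPart A i j)
    (hsum : ∀ s : Fin n → ℝ, (∀ i, 0 ≤ s i) → ∀ i j, Summable fun k =>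
      ((Matrix.diagonal (fun i => (A i i + s i)⁻¹) * offDiagPart A) ^ k) i j)
    {X : Ω → Fin n → ℝ} (hX : IsPermanental P α A⁻¹ X) :
    P.map X = ENNReal.ofReal ((barMatrix A).det ^ α) •
      (permanentalMeasure α (fun i => A i i) (offDiagPart A)).map (orthantCoe n) := by
  have hdet : ∀ s : Fin n → ℝ, (∀ i, 0 ≤ s i) →
      0 < (1 - Matrix.diagonal (fun i => (A i i + s i)⁻¹) * offDiagPart A).det := fun s hs =>
    Matrix.det_one_sub_pos (fun i j => by
      rw [Matrix.diagonal_mul]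
      exact mul_nonneg (inv_nonneg.2 (add_nonneg (hd i).le (hs i))) (hB i j)) (hsum s hs)
  have hbar : 0 < (barMatrix A).det := by
    rw [barMatrix_eq_one_sub hd]
    simpa using hdet 0 fun _ => le_rfl
  have hlap : ∀ s : Fin n → ℝ, (∀ i, 0 ≤ s i) →
      ∫⁻ x, ENNReal.ofReal (Real.exp (-∑ i, s i * x i)) ∂P.map X =
        laplaceTransform (ENNReal.ofReal ((barMatrix A).det ^ α) •
          permanentalMeasure α (fun i => A i i) (offDiagPart A)) s := by
    intro s hs
    rw [lintegral_map' (Measurable.aemeasurable (by fun_prop)) hX.aemeasurable,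
      ← ofReal_integral_eq_lintegral_ofReal (hX.integrable s hs)
        (Eventually.of_forall fun _ => (Real.exp_pos _).le),
      hX.laplace s hs, laplaceTransform_smul,
      laplaceTransform_permanentalMeasure hα hd hs hB (hsum s hs),
      ← ENNReal.ofReal_mul (Real.rpow_nonneg hbar.le α),
      one_div_det_one_add_rpow hd hbar α hs (hdet s hs)]
  have : IsProbabilityMeasure (P.map X) := Measure.isProbabilityMeasure_map hX.aemeasurable
  have : IsFiniteMeasure (ENNReal.ofReal ((barMatrix A).det ^ α) •
      permanentalMeasure α (fun i => A i i) (offDiagPart A)) := by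
    refine ⟨?_⟩
    rw [← laplaceTransform_zero, ← hlap 0 fun _ => le_rfl]
    simp
  rw [eq_map_orthantCoe_of_laplaceTransform_eq hlap, Measure.map_smul]

end Law

theorem theorem3p5 {n : ℕ} {A : Matrix (Fin n) (Fin n) ℝ} (hA : IsNonsingularMMatrix A)
    {α : ℝ} (hα : 0 < α)
    {Ω : Type*} [MeasurableSpace Ω] (P : Measure Ω) [IsProbabilityMeasure P]
    {Ω' : Type*} [MeasurableSpace Ω'] (P' : Measure Ω') [IsProbabilityMeasure P']
    {X : Ω → Fin n → ℝ} (hX : IsPermanental P α A⁻¹ X)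
    {X' : Ω' → Fin n → ℝ} (hX' : IsPermanental P' α (symMatrix A)⁻¹ X')
    (f : (Fin n → ℝ) → ℝ≥0∞) (hf : Measurable f) :
    ENNReal.ofReal ((barMatrix A).det ^ α / (barMatrix (symMatrix A)).det ^ α) *
        ∫⁻ ω, f (X' ω) ∂P' ≤ ∫⁻ ω, f (X ω) ∂P := by
  have hd := hA.diag_pos
  have hB := hA.offDiagPart_nonneg
  have hd' : ∀ i, 0 < symMatrix A i i := fun i => by rw [symMatrix_apply_self]; exact hd i
  have hsum' : ∀ s : Fin n → ℝ, (∀ i, 0 ≤ s i) → ∀ i j, Summable fun k =>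
      ((Matrix.diagonal (fun i => (symMatrix A i i + s i)⁻¹) *
        offDiagPart (symMatrix A)) ^ k) i j := fun s hs => by
    simp only [symMatrix_apply_self, offDiagPart_symMatrix]
    exact hA.summable_geomSymm_pow_apply hs
  have hB' : ∀ i j, 0 ≤ offDiagPart (symMatrix A) i j := fun i j => by
    rw [offDiagPart_symMatrix]; exact geomSymm_nonneg _ i j
  have hlaw := hX.map_eq hα hd hB fun s hs => hA.summable_pow_apply hs
  have hlaw' := hX'.map_eq hα hd' hB' hsum'
  simp only [symMatrix_apply_self, offDiagPart_symMatrix] at hlaw'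
  have hbar' : 0 < (barMatrix (symMatrix A)).det := by
    rw [barMatrix_eq_one_sub hd']
    refine Matrix.det_one_sub_pos (fun i j => ?_) (by simpa using hsum' 0 fun _ => le_rfl)
    rw [Matrix.diagonal_mul]
    exact mul_nonneg (inv_nonneg.2 (hd' i).le) (hB' i j)
  rw [← lintegral_map' hf.aemeasurable hX'.aemeasurable,
    ← lintegral_map' hf.aemeasurable hX.aemeasurable, hlaw, hlaw', lintegral_smul_measure,
    lintegral_smul_measure, smul_eq_mul, smul_eq_mul, ← mul_assoc,
    ← ENNReal.ofReal_mul' (Real.rpow_nonneg hbar'.le α),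
    div_mul_cancel₀ _ (Real.rpow_pos_of_pos hbar' α).ne']
  gcongr
  · exact measurable_orthantCoe
  · exact permanentalMeasure_geomSymm_le hα hd hB
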